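/- All graphs are finite and simple. For a graph $G$ and $A\subset V(G)$, let $G\setminus A$ be the graph obtained from $G$ by deleting the vertices in $A$ and all edges incident to a vertex in $A$, and let $N_G(x)$ be the set of vertices of $G$ adjacent to $x$. A graph is discrete if it has no edges. Let $K$ be a field. For a graph $G$, let $R=K[V(G)]$ be the polynomial ring, with its standard grading, whose variables are the vertices of $G$, and let $I(G)\subset R$ be the edge ideal of $G$, generated by the monomials $xy$ with $\{x,y\}\in E(G)$. The regularity of $R/I(G)$ is $\operatorname{reg}(R/I(G))=\max\{j-i : b_{ij}\neq 0\}$, where $\bigoplus_j R(-j)^{b_{ij}}$ is the $i$-th module of the minimal graded free resolution of $R/I(G)$ over $R$. Theorem. Let $\mathcal F$ be a family of graphs containing every discrete graph, and let $\beta\colon\mathcal F\to\mathbb N$ be a function such that $\beta(G)=0$ for every discrete graph $G$, and such that for every $G\in\mathcal F$ with $E(G)\neq\emptyset$ there is $x\in V(G)$ satisfying the following two conditions: (i) $G\setminus\{x\}$ and $G\setminus(\{x\}\cup N_G(x))$ are in $\mathcal F$; (ii) $\beta(G\setminus(\{x\}\cup N_G(x)))<\beta(G)$ and $\beta(G\setminus\{x\})\leq\beta(G)$.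 Then $\operatorname{reg}(R/I(G))\leq\beta(G)$ for every $G\in\mathcal F$. -/

import Mathlib

open MvPolynomial

universe u v

/-- A finite simple graph, together with its vertex set. -/
structure FinGraph : Type (u + 1) where
  V : Type u
  finite : Finite V
  graph : SimpleGraph V

namespace FinGraph

/-- `G.delete A` is `G ∖ A`: delete the vertices in `A` and all edges incident to them. -/
def delete (G : FinGraph.{u}) (A : Set G.V) : FinGraph.{u} where
  V := (Aᶜ : Set G.V)
  finite := haveI := G.finite; inferInstance
  graph := G.graph.induce Aᶜ

/-- All vertices are isolated (there are no edges). -/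
def IsDiscrete (G : FinGraph.{u}) : Prop := G.graph.edgeSet = ∅

/-- The edge ideal of `G`, in the polynomial ring over `K` whose variables are the vertices. -/
noncomputable def edgeIdeal (G : FinGraph.{u}) (K : Type v) [Field K] :
    Ideal (MvPolynomial G.V K) :=
  Ideal.span {m | ∃ a b : G.V, G.graph.Adj a b ∧ m = X a * X b}

end FinGraph

section Resolutions

variable {σ : Type u} {K : Type v} [Field K]

/-- `p` lies in the degree `n` piece of the standard graded polynomial ring, where `n` is an
integer (the pieces of negative degree are zero). -/
def HasIntDegree (p : MvPolynomial σ K) (n : ℤ) : Prop :=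
  p = 0 ∨ ∃ k : ℕ, (k : ℤ) = n ∧ p.IsHomogeneous k

/-- A graded free resolution of `R ⧸ I`, where `R = K[σ]` has the standard grading:
`0 → F_g → ⋯ → F_1 → F_0 → R ⧸ I → 0`. The module `F_i` is the direct sum of the
shifted modules `R(-shift i a)`, over `a : Fin (rank i)`, so its `a`-th basis vector has degree
`shift i a`, and a vector `v` of `F_i` is homogeneous of degree `n` when every coordinate `v a`
is homogeneous of degree `n - shift i a`. All maps preserve degrees. -/
structure GradedFreeResolution (I : Ideal (MvPolynomial σ K)) where
  rank : ℕ → ℕ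
  shift : (i : ℕ) → Fin (rank i) → ℤ
  d : (i : ℕ) → (Fin (rank (i + 1)) → MvPolynomial σ K) →ₗ[MvPolynomial σ K]
    (Fin (rank i) → MvPolynomial σ K)
  ε : (Fin (rank 0) → MvPolynomial σ K) →ₗ[MvPolynomial σ K] (MvPolynomial σ K ⧸ I)
  finite_length : ∃ g : ℕ, ∀ i, g < i → rank i = 0
  d_degree : ∀ i (a : Fin (rank (i + 1))) (b : Fin (rank i)),
    HasIntDegree (d i (Pi.single a 1) b) (shift (i + 1) a - shift i b)
  ε_degree : ∀ a : Fin (rank 0), ∃ p : MvPolynomial σ K,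
    HasIntDegree p (shift 0 a) ∧ ε (Pi.single a 1) = Ideal.Quotient.mk I p
  ε_surjective : Function.Surjective ε
  exact_zero : Function.Exact (d 0) ε
  exact_succ : ∀ i, Function.Exact (d (i + 1)) (d i)

namespace GradedFreeResolution

variable {I : Ideal (MvPolynomial σ K)}

/-- The resolution is minimal: the image of `F_{i+1}` lies in `𝔪 F_i` for every `i`, where `𝔪`
is the ideal generated by the variables. -/
def IsMinimal (F : GradedFreeResolution I) : Prop :=
  ∀ i, LinearMap.range (F.d i) ≤
    (Ideal.span (Set.range (X : σ → MvPolynomial σ K))) •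
      (⊤ : Submodule (MvPolynomial σ K) (Fin (F.rank i) → MvPolynomial σ K))

/-- The number `b_{ij}` of summands `R(-j)` of `F_i`. -/
def betti (F : GradedFreeResolution I) (i : ℕ) (j : ℤ) : ℕ :=
  (Finset.univ.filter fun a : Fin (F.rank i) => F.shift i a = j).card

end GradedFreeResolution

/-- `reg (R ⧸ I) = r`: there is a minimal graded free resolution of `R ⧸ I`, and
`r = max {j - i | b_{ij} ≠ 0}` for any such resolution. -/
def HasRegularity (I : Ideal (MvPolynomial σ K)) (r : ℤ) : Prop :=
  (∃ F : GradedFreeResolution I, F.IsMinimal) ∧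
    ∀ F : GradedFreeResolution I, F.IsMinimal →
      IsGreatest {n : ℤ | ∃ (i : ℕ) (j : ℤ), F.betti i j ≠ 0 ∧ n = j - i} r

end Resolutions

/-! For a vertex `x` of `G` put `I = I(G)`. The exact sequence `0 → R/(I : x)(-1) → R/I → R/(I +
(x)) → 0`, whose first map is multiplication by `x`, gives reg(R/I) ≤ max(reg(R/(I : x)) + 1,
reg(R/(I + (x)))). The colon ideal is generated by the edges of `G` minus the closed neighbourhood
of `x` together with the variables in `N(x)`, and `I + (x)` by the edges of `G ∖ x` together with
`x`. Extra variables that meet no remaining edge do not affect the bound, so induction on the number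
of vertices applies: the strict drop of `β` pays for the summand `+ 1`. The base case, an ideal of
variables, is resolved by a Koszul complex.

The induction (`regLE_edgeVarIdeal`) works with `RegLE`, which asks for some finite graded
resolution with bounded shifts, not necessarily minimal. Such resolutions are glued by mapping cones
(`RegLE.sup_span`) and by the horseshoe construction (`RegLE.of_colon_of_sup`). The passage to the
true regularity rests on `FreeRes.card_shift_le`: a minimal resolution has the fewest generators in
every homological and internal degree. This transfers the bound, makes the graded Betti numbers
independent of the minimal resolution, and forces the minimal resolution built from iterated
syzygies to be finite, without Hilbert's syzygy theorem. -/

/-! ### Integer grading on polynomials and free modules, graded maps and lifts -/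

section Grading

variable {σ : Type u} {K : Type v} [Field K]

/-- Homogeneity of polynomials with respect to the standard grading, with integer degrees. -/
abbrev IsHomog (p : MvPolynomial σ K) (n : ℤ) : Prop :=
  IsWeightedHomogeneous (fun _ : σ => (1 : ℤ)) p n

/-- The homogeneous component of integer degree `n`. -/
noncomputable abbrev homogComp (n : ℤ) : MvPolynomial σ K →ₗ[K] MvPolynomial σ K :=
  weightedHomogeneousComponent (fun _ : σ => (1 : ℤ)) n

theorem weight_one_int (m : σ →₀ ℕ) :
    Finsupp.weight (fun _ : σ => (1 : ℤ)) m = (m.degree : ℤ) := by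
  simp [Finsupp.weight_apply, Finsupp.degree_apply, Finsupp.sum]

theorem coeff_homogComp (n : ℤ) (p : MvPolynomial σ K) (m : σ →₀ ℕ) :
    coeff m (homogComp n p) = if (m.degree : ℤ) = n then coeff m p else 0 := by
  rw [coeff_weightedHomogeneousComponent, weight_one_int]

theorem isHomog_iff {p : MvPolynomial σ K} {n : ℤ} :
    IsHomog p n ↔ ∀ m, coeff m p ≠ 0 → (m.degree : ℤ) = n := by
  simp only [IsHomog, IsWeightedHomogeneous, weight_one_int]

theorem isHomog_homogComp (n : ℤ) (p : MvPolynomial σ K) : IsHomog (homogComp n p) n :=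
  weightedHomogeneousComponent_isWeightedHomogeneous n p

theorem homogComp_eq_self_iff {p : MvPolynomial σ K} {n : ℤ} :
    homogComp n p = p ↔ IsHomog p n :=
  ⟨fun h => h ▸ isHomog_homogComp n p, fun h => h.weightedHomogeneousComponent_same⟩

theorem homogComp_mul {p q : MvPolynomial σ K} {l : ℤ} (hq : IsHomog q l) (n : ℤ) :
    homogComp n (p * q) = homogComp (n - l) p * q := by
  classical
  ext m
  rw [coeff_homogComp, coeff_mul, coeff_mul]
  trans ∑ x ∈ Finset.HasAntidiagonal.antidiagonal m, if (m.degree : ℤ) = n then coeff x.1 p * coeff x.2 q else 0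
  · split_ifs <;> simp
  refine Finset.sum_congr rfl fun x hx => ?_
  rw [coeff_homogComp]
  by_cases h : coeff x.2 q = 0
  · simp [h]
  · have h1 := isHomog_iff.mp hq _ h
    have h2 : x.1.degree + x.2.degree = m.degree := by
      rw [← map_add, Finset.HasAntidiagonal.mem_antidiagonal.mp hx]
    have h3 : (m.degree : ℤ) = n ↔ (x.1.degree : ℤ) = n - l := by omega
    simp only [h3, ite_mul, zero_mul]

theorem hasIntDegree_iff {p : MvPolynomial σ K} {n : ℤ} : HasIntDegree p n ↔ IsHomog p n := by
  rw [isHomog_iff]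
  constructor
  · rintro (rfl | ⟨k, rfl, h⟩) m hm
    · simp at hm
    · have := h hm
      rw [← this, Finsupp.degree_eq_weight_one]; rfl
  · intro h
    by_cases hp : p = 0
    · exact Or.inl hp
    · obtain ⟨m, hm⟩ := ne_zero_iff.mp hp
      refine Or.inr ⟨m.degree, h m hm, fun m' hm' => ?_⟩
      have h1 := h m hm
      have h2 := h m' hm'
      have : m'.degree = m.degree := by omega
      rw [← this, Finsupp.degree_eq_weight_one]; rfl

theorem constantCoeff_eq_zero_of_isHomog {p : MvPolynomial σ K} {n : ℤ} (h : IsHomog p n)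
    (hn : n ≠ 0) : constantCoeff p = 0 := by
  by_contra h0
  exact hn (by simpa using (isHomog_iff.mp h 0 h0).symm)

theorem homogComp_zero_eq (p : MvPolynomial σ K) : homogComp 0 p = C (constantCoeff p) := by
  classical
  ext m
  rw [coeff_homogComp, coeff_C, constantCoeff_eq]
  by_cases h : m = 0
  · simp [h]
  · have : m.degree ≠ 0 := fun h' => h ((Finsupp.degree_eq_zero_iff m).mp h')
    simp [Ne.symm h, this]

/-- Allowing every larger `t` lets all coordinates of a vector share one finite set of degrees. -/
theorem exists_sum_homogComp (p : MvPolynomial σ K) :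
    ∃ s : Finset ℤ, ∀ t : Finset ℤ, s ⊆ t → ∑ n ∈ t, homogComp n p = p := by
  classical
  refine ⟨p.support.image fun m => (m.degree : ℤ), fun t ht => ?_⟩
  ext m
  rw [coeff_sum]
  simp only [coeff_homogComp]
  rw [Finset.sum_ite_eq]
  split_ifs with h
  · rfl
  · by_contra h0
    exact h (ht (Finset.mem_image_of_mem _ (mem_support_iff.mpr (Ne.symm h0))))

/-- The homogeneous component of degree `n` of a vector in the free module whose `a`-th basis
vector has degree `s a`. -/
noncomputable def vecComp {ι : Type*} (s : ι → ℤ) (n : ℤ) :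
    (ι → MvPolynomial σ K) →ₗ[K] (ι → MvPolynomial σ K) where
  toFun v a := homogComp (n - s a) (v a)
  map_add' _ _ := by ext; simp
  map_smul' _ _ := by ext; simp

theorem vecComp_apply {ι : Type*} (s : ι → ℤ) (n : ℤ) (v : ι → MvPolynomial σ K) (a : ι) :
    vecComp s n v a = homogComp (n - s a) (v a) := rfl

theorem vecComp_eq_self_iff {ι : Type*} {s : ι → ℤ} {n : ℤ} {v : ι → MvPolynomial σ K} :
    vecComp s n v = v ↔ ∀ a, IsHomog (v a) (n - s a) := by
  simp only [funext_iff, vecComp_apply, homogComp_eq_self_iff]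

theorem vecComp_vecComp {ι : Type*} (s : ι → ℤ) (n : ℤ) (v : ι → MvPolynomial σ K) :
    vecComp s n (vecComp s n v) = vecComp s n v :=
  vecComp_eq_self_iff.mpr fun _ => isHomog_homogComp _ _

theorem vecComp_smul {ι : Type*} {s : ι → ℤ} {l : ℤ} {w : ι → MvPolynomial σ K}
    (hw : vecComp s l w = w) (n : ℤ) (p : MvPolynomial σ K) :
    vecComp s n (p • w) = homogComp (n - l) p • w := by
  ext1 a
  rw [vecComp_apply, Pi.smul_apply, smul_eq_mul, homogComp_mul (vecComp_eq_self_iff.mp hw a)]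
  simp

theorem exists_sum_vecComp {ι : Type*} [Finite ι] (s : ι → ℤ) (v : ι → MvPolynomial σ K) :
    ∃ t : Finset ℤ, ∑ n ∈ t, vecComp s n v = v := by
  classical
  have := Fintype.ofFinite ι
  choose t ht using fun a => exists_sum_homogComp (v a)
  refine ⟨Finset.univ.biUnion fun a => (t a).image (· + s a), ?_⟩
  ext1 a
  rw [Finset.sum_apply]
  simp only [vecComp_apply]
  rw [← Finset.sum_image (f := fun n => homogComp n (v a)) (g := fun n => n - s a)
    (fun x _ y _ h => by simpa using h)]
  refine ht a _ fun n hn => ?_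
  exact Finset.mem_image.mpr ⟨n + s a, Finset.mem_biUnion.mpr
    ⟨a, Finset.mem_univ _, Finset.mem_image_of_mem _ hn⟩, by simp⟩

theorem vecComp_single {ι : Type*} [DecidableEq ι] (s : ι → ℤ) (a : ι) :
    vecComp s (s a) (Pi.single a (1 : MvPolynomial σ K)) = Pi.single a 1 := by
  rw [vecComp_eq_self_iff]
  intro b
  by_cases h : b = a
  · subst h
    simpa using isWeightedHomogeneous_one K (fun _ : σ => (1 : ℤ))
  · rw [Pi.single_eq_of_ne h]
    exact isWeightedHomogeneous_zero K _ _

/-- A linear map between graded free modules is graded of degree zero. -/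
def IsGraded {ι κ : Type*} (s : ι → ℤ) (t : κ → ℤ)
    (f : (ι → MvPolynomial σ K) →ₗ[MvPolynomial σ K] (κ → MvPolynomial σ K)) : Prop :=
  ∀ n v, f (vecComp s n v) = vecComp t n (f v)

theorem isGraded_of_single {ι κ : Type*} [Finite ι] [DecidableEq ι] {s : ι → ℤ} {t : κ → ℤ}
    {f : (ι → MvPolynomial σ K) →ₗ[MvPolynomial σ K] (κ → MvPolynomial σ K)}
    (h : ∀ a, vecComp t (s a) (f (Pi.single a 1)) = f (Pi.single a 1)) : IsGraded s t f := by
  have := Fintype.ofFinite ι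
  intro n v
  have hv : ∀ v, f v = ∑ a, v a • f (Pi.single a 1) := fun v => by
    conv_lhs => rw [pi_eq_sum_univ' v]
    simp [map_sum]
  rw [hv v, map_sum, hv]
  exact Finset.sum_congr rfl fun a _ => (vecComp_smul (h a) n (v a)).symm

theorem IsGraded.single {ι κ : Type*} [DecidableEq ι] {s : ι → ℤ} {t : κ → ℤ}
    {f : (ι → MvPolynomial σ K) →ₗ[MvPolynomial σ K] (κ → MvPolynomial σ K)}
    (h : IsGraded s t f) (a : ι) :
    vecComp t (s a) (f (Pi.single a 1)) = f (Pi.single a 1) := by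
  rw [← h, vecComp_single]

theorem exists_linearMap_single {ι M : Type*} [Finite ι] [DecidableEq ι] [AddCommGroup M]
    [Module (MvPolynomial σ K) M] {P : ι → M → Prop} (h : ∀ a, ∃ x, P a x) :
    ∃ f : (ι → MvPolynomial σ K) →ₗ[MvPolynomial σ K] M, ∀ a, P a (f (Pi.single a 1)) := by
  have := Fintype.ofFinite ι
  choose x hx using h
  refine ⟨(Pi.basisFun (MvPolynomial σ K) ι).constr ℕ x, fun a => ?_⟩
  have := (Pi.basisFun (MvPolynomial σ K) ι).constr_basis ℕ x a
  rw [Pi.basisFun_apply] at this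
  convert hx a

theorem exists_lift {ι B A : Type*} [Finite ι] [AddCommGroup A] [Module (MvPolynomial σ K) A]
    [AddCommGroup B] [Module (MvPolynomial σ K) B]
    (f : (ι → MvPolynomial σ K) →ₗ[MvPolynomial σ K] B) (g : A →ₗ[MvPolynomial σ K] B)
    (h : ∀ v, f v ∈ LinearMap.range g) :
    ∃ k : (ι → MvPolynomial σ K) →ₗ[MvPolynomial σ K] A, ∀ v, g (k v) = f v := by
  classical
  obtain ⟨k, hk⟩ := exists_linearMap_single (σ := σ) (K := K) (P := fun a x => g x = f (Pi.single a 1))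
    (fun a => h _)
  refine ⟨k, LinearMap.congr_fun (f := g ∘ₗ k) (LinearMap.pi_ext' fun a => ?_)⟩
  ext
  simpa using hk a

/-- A free module is mapped by choosing images of basis vectors; replacing each image by its
component in the degree of the basis vector makes the map graded, provided the required property
survives this. -/
theorem exists_graded_map {ι κ : Type*} [Finite ι] [DecidableEq ι] (s : ι → ℤ) (t : κ → ℤ)
    {P : ι → (κ → MvPolynomial σ K) → Prop}
    (h : ∀ a, ∃ x, P a x) (hP : ∀ a x, P a x → P a (vecComp t (s a) x)) :
    ∃ f : (ι → MvPolynomial σ K) →ₗ[MvPolynomial σ K] (κ → MvPolynomial σ K),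
      IsGraded s t f ∧ ∀ a, P a (f (Pi.single a 1)) := by
  obtain ⟨f, hf⟩ := exists_linearMap_single (σ := σ) (K := K) (P := fun a x => P a x ∧ vecComp t (s a) x = x)
    (fun a => let ⟨x, hx⟩ := h a; ⟨_, hP a x hx, vecComp_vecComp _ _ _⟩)
  exact ⟨f, isGraded_of_single fun a => (hf a).2, fun a => (hf a).1⟩

theorem exists_graded_lift {ι κ μ : Type*} [Finite ι] {s : ι → ℤ} {t : κ → ℤ}
    {r : μ → ℤ}
    {f : (ι → MvPolynomial σ K) →ₗ[MvPolynomial σ K] (κ → MvPolynomial σ K)}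
    {g : (μ → MvPolynomial σ K) →ₗ[MvPolynomial σ K] (κ → MvPolynomial σ K)}
    (hf : IsGraded s t f) (hg : IsGraded r t g) (h : ∀ v, f v ∈ LinearMap.range g) :
    ∃ k : (ι → MvPolynomial σ K) →ₗ[MvPolynomial σ K] (μ → MvPolynomial σ K),
      IsGraded s r k ∧ ∀ v, g (k v) = f v := by
  classical
  obtain ⟨k, hk, hk'⟩ := exists_graded_map s r (P := fun a x => g x = f (Pi.single a 1))
    (fun a => h _) (fun a x hx => by rw [hg, hx, hf.single])
  refine ⟨k, hk, LinearMap.congr_fun (f := g ∘ₗ k) (LinearMap.pi_ext' fun a => ?_)⟩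
  ext1
  simpa using hk' a

/-- Chain maps and homotopies are built degree by degree: `P` is the invariant that makes the next
lift possible, `Q` the relation between consecutive maps. -/
theorem exists_dependent_seq {α : ℕ → Type*} {P : ∀ i, α i → Prop}
    {Q : ∀ i, α i → α (i + 1) → Prop} (a₀ : α 0) (h₀ : P 0 a₀)
    (h : ∀ i a, P i a → ∃ b, P (i + 1) b ∧ Q i a b) :
    ∃ f : ∀ i, α i, f 0 = a₀ ∧ (∀ i, P i (f i)) ∧ ∀ i, Q i (f i) (f (i + 1)) := by
  choose g hg using h
  let F : ∀ i, {a : α i // P i a} := fun i =>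
    Nat.rec ⟨a₀, h₀⟩ (fun i a => ⟨g i a.1 a.2, (hg i a.1 a.2).1⟩) i
  exact ⟨fun i => (F i).1, rfl, fun i => (F i).2, fun i => (hg i (F i).1 (F i).2).2⟩

theorem constantCoeff_map_eq_zero {ι κ : Type*} [Finite ι]
    (f : (ι → MvPolynomial σ K) →ₗ[MvPolynomial σ K] (κ → MvPolynomial σ K))
    {v : ι → MvPolynomial σ K} (hv : ∀ a, constantCoeff (v a) = 0) (b : κ) :
    constantCoeff (f v b) = 0 := by
  classical
  have := Fintype.ofFinite ι
  rw [pi_eq_sum_univ' v]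
  simp [map_sum, hv]

end Grading

/-! ### Comparison of graded free resolutions -/

section FreeResolutions

variable {σ : Type u} {K : Type v} [Field K]

/-- A graded free resolution of the quotient by `I`, possibly of infinite length, indexed by
arbitrary finite types; the augmentation is given by its lift `e` to the polynomial ring. -/
structure FreeRes (I : Ideal (MvPolynomial σ K)) where
  ι : ℕ → Type
  finite : ∀ i, Finite (ι i)
  shift : ∀ i, ι i → ℤ
  d : ∀ i, (ι (i + 1) → MvPolynomial σ K) →ₗ[MvPolynomial σ K] (ι i → MvPolynomial σ K)
  e : (ι 0 → MvPolynomial σ K) →ₗ[MvPolynomial σ K] (Unit → MvPolynomial σ K)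
  graded_d : ∀ i, IsGraded (shift (i + 1)) (shift i) (d i)
  graded_e : IsGraded (shift 0) 0 e
  surj : ∀ q, ∃ v, q - e v () ∈ I
  exact_e : ∀ v, e v () ∈ I ↔ v ∈ LinearMap.range (d 0)
  exact_d : ∀ i, Function.Exact (d (i + 1)) (d i)

attribute [instance] FreeRes.finite

/-- Closure under taking homogeneous components. -/
def IsHomogIdeal (I : Ideal (MvPolynomial σ K)) : Prop :=
  ∀ p ∈ I, ∀ n, homogComp n p ∈ I

namespace FreeRes

variable {I : Ideal (MvPolynomial σ K)}

theorem d_d (F : FreeRes I) (i : ℕ) (v : F.ι (i + 2) → MvPolynomial σ K) :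
    F.d i (F.d (i + 1) v) = 0 :=
  (F.exact_d i).apply_apply_eq_zero v

theorem e_d (F : FreeRes I) (v : F.ι 1 → MvPolynomial σ K) : F.e (F.d 0 v) () ∈ I :=
  (F.exact_e _).mpr ⟨v, rfl⟩

/-- Every differential has entries in the ideal generated by the variables. -/
def IsMin (F : FreeRes I) : Prop := ∀ i v b, constantCoeff (F.d i v b) = 0

theorem e_vecComp (F : FreeRes I) (n : ℤ) (v : F.ι 0 → MvPolynomial σ K) :
    F.e (vecComp (F.shift 0) n v) () = homogComp n (F.e v ()) := by
  rw [F.graded_e, vecComp_apply]; simp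

/-- The comparison theorem. Since `e` lifts the augmentation to `R`, compatibility in degree zero
holds only modulo `I`. -/
theorem exists_hom (hI : IsHomogIdeal I) (F F' : FreeRes I) :
    ∃ φ : ∀ i, (F.ι i → MvPolynomial σ K) →ₗ[MvPolynomial σ K] (F'.ι i → MvPolynomial σ K),
      (∀ i, IsGraded (F.shift i) (F'.shift i) (φ i)) ∧
      (∀ v, F.e v () - F'.e (φ 0 v) () ∈ I) ∧
      ∀ i v, F'.d i (φ (i + 1) v) = φ i (F.d i v) := by
  classical
  obtain ⟨φ₀, hg, h₀⟩ := exists_graded_map (F.shift 0) (F'.shift 0)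
    (P := fun a x => F.e (Pi.single a 1) () - F'.e x () ∈ I)
    (fun a => F'.surj _) (fun a x hx => by
      have := hI _ hx (F.shift 0 a)
      rwa [map_sub, ← e_vecComp, ← e_vecComp, vecComp_single] at this)
  have h₀' : ∀ v, F.e v () - F'.e (φ₀ v) () ∈ I := by
    intro v
    have := Fintype.ofFinite (F.ι 0)
    rw [pi_eq_sum_univ' v]
    simp only [map_sum, map_smul, Finset.sum_apply, ← Finset.sum_sub_distrib, Pi.smul_apply,
      ← smul_sub]
    exact I.sum_mem fun a _ => I.mul_mem_left _ (h₀ a)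
  obtain ⟨φ, h0, hP, hQ⟩ := exists_dependent_seq
    (α := fun i => (F.ι i → MvPolynomial σ K) →ₗ[MvPolynomial σ K] (F'.ι i → MvPolynomial σ K))
    -- The range condition is what allows `φ ∘ d` to be lifted through the next differential;
    -- exactness of `F'` propagates it.
    (P := fun i φ => IsGraded (F.shift i) (F'.shift i) φ ∧
      ∀ v, φ (F.d i v) ∈ LinearMap.range (F'.d i))
    (Q := fun i φ φ' => ∀ v, F'.d i (φ' v) = φ (F.d i v)) φ₀
    ⟨hg, fun v => (F'.exact_e _).mp ((Submodule.sub_mem_iff_right _ (F.e_d v)).mp (h₀' _))⟩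
    (fun i φ ⟨h1, h2⟩ => by
      obtain ⟨k, hk, hk'⟩ := exists_graded_lift (s := F.shift (i + 1)) (f := φ ∘ₗ F.d i)
        (g := F'.d i) (fun n v => by simp [F.graded_d i n v, h1 n]) (F'.graded_d i) h2
      refine ⟨k, ⟨hk, fun v => ?_⟩, hk'⟩
      refine (F'.exact_d i _).mp ?_
      rw [hk', LinearMap.comp_apply, d_d, map_zero])
  exact ⟨φ, fun i => (hP i).1, by rw [h0]; exact h₀', hQ⟩

/-- A chain endomorphism inducing zero on `R/I` is null-homotopic. The homotopy need not be graded,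
since only its constant coefficients are used later. -/
theorem exists_homotopy (F : FreeRes I)
    (θ : ∀ i, (F.ι i → MvPolynomial σ K) →ₗ[MvPolynomial σ K] (F.ι i → MvPolynomial σ K))
    (h₀ : ∀ v, F.e (θ 0 v) () ∈ I) (h : ∀ i v, F.d i (θ (i + 1) v) = θ i (F.d i v)) :
    ∃ k : ∀ i, (F.ι i → MvPolynomial σ K) →ₗ[MvPolynomial σ K] (F.ι (i + 1) → MvPolynomial σ K),
      (∀ v, θ 0 v = F.d 0 (k 0 v)) ∧
      ∀ i v, θ (i + 1) v = F.d (i + 1) (k (i + 1) v) + k i (F.d i v) := by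
  obtain ⟨k₀, hk₀⟩ := exists_lift (θ 0) (F.d 0) (fun v => (F.exact_e _).mp (h₀ v))
  obtain ⟨k, h0, hP, hQ⟩ := exists_dependent_seq
    (α := fun i => (F.ι i → MvPolynomial σ K) →ₗ[MvPolynomial σ K]
      (F.ι (i + 1) → MvPolynomial σ K))
    -- This says that `θ (i + 1) - k ∘ d` takes values in cycles, hence lifts by exactness.
    (P := fun i k => ∀ v, θ i (F.d i v) = F.d i (k (F.d i v)))
    (Q := fun i k k' => ∀ v, θ (i + 1) v = F.d (i + 1) (k' v) + k (F.d i v)) k₀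
    (fun v => (hk₀ _).symm) (fun i k hk => by
      obtain ⟨k', hk'⟩ := exists_lift (θ (i + 1) - k ∘ₗ F.d i) (F.d (i + 1)) (fun v => by
        refine (F.exact_d i _).mp ?_
        simp [h, hk])
      refine ⟨k', fun v => ?_, fun v => ?_⟩
      · simp [hk', d_d]
      · simp [hk'])
  exact ⟨k, fun v => by rw [h0, hk₀], hQ⟩

/-- Comparison maps `φ`, `ψ` in both directions compose to an endomorphism of `F` homotopic to the
identity. As `F` is minimal, the homotopy terms vanish modulo the variables, so `φ` tensored with
`K` has a left inverse and is injective in each degree. Minimality of `F'` plays no role. -/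
theorem card_shift_le (hI : IsHomogIdeal I) (F F' : FreeRes I) (hF : F.IsMin) (i : ℕ) (j : ℤ) :
    Nat.card {a // F.shift i a = j} ≤ Nat.card {b // F'.shift i b = j} := by
  classical
  obtain ⟨φ, hφg, hφ₀, hφ⟩ := exists_hom hI F F'
  obtain ⟨ψ, -, hψ₀, hψ⟩ := exists_hom hI F' F
  obtain ⟨k, hk₀, hk⟩ := F.exists_homotopy (fun i => ψ i ∘ₗ φ i - LinearMap.id)
    (fun v => by
      have := I.add_mem (hφ₀ v) (hψ₀ (φ 0 v))
      rw [sub_add_sub_cancel] at this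
      simpa using I.neg_mem this)
    (fun i v => by simp [hφ, hψ])
  have key : ∀ i v b, constantCoeff (ψ i (φ i v) b) = constantCoeff (v b) := by
    intro i v b
    have : constantCoeff ((ψ i (φ i v) - v) b) = 0 := by
      cases i with
      | zero =>
        have := hk₀ v
        simp only [LinearMap.sub_apply, LinearMap.comp_apply, LinearMap.id_apply] at this
        rw [this, hF]
      | succ i =>
        have := hk i v
        simp only [LinearMap.sub_apply, LinearMap.comp_apply, LinearMap.id_apply] at this
        rw [this, Pi.add_apply, map_add, hF, constantCoeff_map_eq_zero _ (hF i v), add_zero]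
    rwa [Pi.sub_apply, map_sub, sub_eq_zero] at this
  let ext : ({a // F.shift i a = j} → K) →ₗ[K] (F.ι i → MvPolynomial σ K) :=
    { toFun := fun c a => if h : F.shift i a = j then C (c ⟨a, h⟩) else 0
      map_add' := fun c c' => by ext1 a; by_cases h : F.shift i a = j <;> simp [h]
      map_smul' := fun r c => by
        ext1 a; by_cases h : F.shift i a = j <;> simp [h, smul_eq_C_mul] }
  have hext : ∀ c, vecComp (F.shift i) j (ext c) = ext c := fun c => by
    rw [vecComp_eq_self_iff]
    intro a
    by_cases h : F.shift i a = j
    · simp only [ext, LinearMap.coe_mk, AddHom.coe_mk, h, dite_true, sub_self]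
      exact isWeightedHomogeneous_C _ _
    · simp only [ext, LinearMap.coe_mk, AddHom.coe_mk, h, dite_false]
      exact isWeightedHomogeneous_zero _ _ _
  let Φ : ({a // F.shift i a = j} → K) →ₗ[K] ({b // F'.shift i b = j} → K) :=
    { toFun := fun c b => constantCoeff (φ i (ext c) b.1)
      map_add' := fun c c' => by ext1; simp
      map_smul' := fun r c => by ext1; simp }
  have hΦ : Function.Injective Φ := by
    rw [← LinearMap.ker_eq_bot, LinearMap.ker_eq_bot']
    intro c hc
    -- The vector `φ i (ext c)` is homogeneous of degree `j`, so its constants can only sit on basis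
    -- vectors of degree `j`; restricting to those in `Φ` loses nothing.
    have h1 : ∀ b, constantCoeff (φ i (ext c) b) = 0 := by
      intro b
      by_cases h : F'.shift i b = j
      · exact congrFun hc ⟨b, h⟩
      · have := hφg i j (ext c)
        rw [hext, eq_comm, vecComp_eq_self_iff] at this
        exact constantCoeff_eq_zero_of_isHomog (this b) (by omega)
    ext1 a
    have h2 := key i (ext c) a.1
    rw [constantCoeff_map_eq_zero _ h1] at h2
    simpa [ext, a.2] using h2.symm
  have := Fintype.ofFinite {a // F.shift i a = j}
  have := Fintype.ofFinite {b // F'.shift i b = j}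
  simpa using LinearMap.finrank_le_finrank_of_injective hΦ

end FreeRes

end FreeResolutions

/-! ### Block matrices of graded maps -/

section Blocks

variable {σ : Type u} {K : Type v} [Field K] {A B C D : Type*}

local notation "R" => MvPolynomial σ K

/-- The linear map with block matrix `(f g)`. -/
noncomputable def rowMap (f : (A → R) →ₗ[R] (C → R)) (g : (B → R) →ₗ[R] (C → R)) :
    (A ⊕ B → R) →ₗ[R] (C → R) :=
  f ∘ₗ LinearMap.funLeft R R Sum.inl + g ∘ₗ LinearMap.funLeft R R Sum.inr

/-- The linear map with upper triangular block matrix `(f g; 0 h)`. -/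
noncomputable def triMap (f : (A → R) →ₗ[R] (C → R)) (g : (B → R) →ₗ[R] (C → R))
    (h : (B → R) →ₗ[R] (D → R)) : (A ⊕ B → R) →ₗ[R] (C ⊕ D → R) where
  toFun v := Sum.elim (f (v ∘ Sum.inl) + g (v ∘ Sum.inr)) (h (v ∘ Sum.inr))
  map_add' v w := by
    change Sum.elim (f (v ∘ Sum.inl + w ∘ Sum.inl) + g (v ∘ Sum.inr + w ∘ Sum.inr))
      (h (v ∘ Sum.inr + w ∘ Sum.inr)) = _
    ext1 (c | c)
    · simp [add_add_add_comm]
    · simp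
  map_smul' r v := by
    change Sum.elim (f (r • (v ∘ Sum.inl)) + g (r • (v ∘ Sum.inr))) (h (r • (v ∘ Sum.inr))) = _
    ext1 (c | c) <;> simp [mul_add]

theorem rowMap_apply (f : (A → R) →ₗ[R] (C → R)) (g : (B → R) →ₗ[R] (C → R)) (v : A ⊕ B → R) :
    rowMap f g v = f (v ∘ Sum.inl) + g (v ∘ Sum.inr) := rfl

theorem triMap_apply (f : (A → R) →ₗ[R] (C → R)) (g : (B → R) →ₗ[R] (C → R))
    (h : (B → R) →ₗ[R] (D → R)) (v : A ⊕ B → R) :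
    triMap f g h v = Sum.elim (f (v ∘ Sum.inl) + g (v ∘ Sum.inr)) (h (v ∘ Sum.inr)) := rfl

theorem vecComp_elim (s : A → ℤ) (t : B → ℤ) (n : ℤ) (v : A → R) (w : B → R) :
    vecComp (Sum.elim s t) n (Sum.elim v w) = Sum.elim (vecComp s n v) (vecComp t n w) := by
  ext1 (a | a) <;> rfl

theorem IsGraded.rowMap {s : A → ℤ} {t : B → ℤ} {r : C → ℤ} {f : (A → R) →ₗ[R] (C → R)}
    {g : (B → R) →ₗ[R] (C → R)} (hf : IsGraded s r f) (hg : IsGraded t r g) :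
    IsGraded (Sum.elim s t) r (rowMap f g) := by
  intro n v
  rw [rowMap_apply, rowMap_apply, map_add, ← hf, ← hg]
  rfl

theorem IsGraded.triMap {s : A → ℤ} {t : B → ℤ} {r : C → ℤ} {q : D → ℤ}
    {f : (A → R) →ₗ[R] (C → R)} {g : (B → R) →ₗ[R] (C → R)} {h : (B → R) →ₗ[R] (D → R)}
    (hf : IsGraded s r f) (hg : IsGraded t r g) (hh : IsGraded t q h) :
    IsGraded (Sum.elim s t) (Sum.elim r q) (triMap f g h) := by
  intro n v
  rw [triMap_apply, triMap_apply, vecComp_elim, map_add, ← hf, ← hg, ← hh]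
  rfl

theorem vecComp_add_one (s : A → ℤ) (n : ℤ) :
    vecComp (σ := σ) (K := K) (fun a => s a + 1) n = vecComp s (n - 1) := by
  ext1 v
  ext1 a
  rw [vecComp_apply, vecComp_apply]
  congr 2
  ring

theorem IsGraded.add_one {s : A → ℤ} {t : B → ℤ} {f : (A → R) →ₗ[R] (B → R)}
    (h : IsGraded s t f) : IsGraded (fun a => s a + 1) (fun b => t b + 1) f := by
  intro n v
  rw [vecComp_add_one, vecComp_add_one, h]

theorem IsGraded.smul {s : A → ℤ} {t : B → ℤ} {f : (A → R) →ₗ[R] (B → R)}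
    (h : IsGraded s t f) {x : R} (hx : IsHomog x 1) :
    IsGraded (fun a => s a + 1) t (x • f) := by
  intro n v
  rw [vecComp_add_one, LinearMap.smul_apply, h, LinearMap.smul_apply]
  ext1 b
  rw [Pi.smul_apply, vecComp_apply, vecComp_apply, Pi.smul_apply, smul_eq_mul, smul_eq_mul,
    mul_comm x (f v b), homogComp_mul hx, mul_comm, sub_right_comm]

theorem IsGraded.neg {s : A → ℤ} {t : B → ℤ} {f : (A → R) →ₗ[R] (B → R)}
    (h : IsGraded s t f) : IsGraded s t (-f) := by
  intro n v
  simp [h n v]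

theorem IsGraded.comp {s : A → ℤ} {t : B → ℤ} {r : C → ℤ} {f : (A → R) →ₗ[R] (B → R)}
    {g : (B → R) →ₗ[R] (C → R)} (hg : IsGraded t r g) (hf : IsGraded s t f) :
    IsGraded s r (g ∘ₗ f) := by
  intro n v
  rw [LinearMap.comp_apply, hf, hg, LinearMap.comp_apply]

theorem isGraded_id (s : A → ℤ) : IsGraded s s (LinearMap.id : (A → R) →ₗ[R] (A → R)) :=
  fun _ _ => rfl

end Blocks

/-! ### Regularity bounds from mapping cones and the horseshoe construction -/

section Regularity

variable {σ : Type u} {K : Type v} [Field K]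

local notation "R" => MvPolynomial σ K

/-- The quotient by `I` has a finite graded free resolution whose `i`-th module is generated in
degrees at most `i + r`. -/
def RegLE (I : Ideal R) (r : ℤ) : Prop :=
  ∃ F : FreeRes I, (∃ g, ∀ i, g < i → IsEmpty (F.ι i)) ∧ ∀ i a, F.shift i a ≤ i + r

/-- The polynomial ring as a resolution of itself. -/
noncomputable def FreeRes.bot : FreeRes (⊥ : Ideal R) where
  ι
    | 0 => Unit
    | _ + 1 => Empty
  finite
    | 0 => inferInstanceAs (Finite Unit)
    | _ + 1 => inferInstanceAs (Finite Empty)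
  shift _ _ := 0
  d _ := 0
  e := LinearMap.id
  graded_d _ _ _ := by simp
  graded_e _ _ := rfl
  surj q := ⟨fun _ => q, by simp⟩
  exact_e v := by
    simp only [LinearMap.id_apply, Ideal.mem_bot, LinearMap.range_zero, Submodule.mem_bot]
    exact ⟨fun h => funext fun _ => h, fun h => congrFun h ()⟩
  exact_d _ v := by
    exact ⟨fun _ => ⟨0, funext fun a => a.elim⟩, fun _ => rfl⟩

theorem RegLE.bot : RegLE (⊥ : Ideal R) 0 :=
  ⟨FreeRes.bot, ⟨0, fun i hi => by
    obtain ⟨i, rfl⟩ := Nat.exists_eq_succ_of_ne_zero hi.ne'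
    exact inferInstanceAs (IsEmpty Empty)⟩, fun i _ => by simp [FreeRes.bot]⟩

theorem RegLE.mono {I : Ideal R} {r s : ℤ} (h : RegLE I r) (hrs : r ≤ s) : RegLE I s := by
  obtain ⟨F, hg, hF⟩ := h
  exact ⟨F, hg, fun i a => (hF i a).trans (by omega)⟩

namespace FreeRes

/-- The mapping cone of multiplication by a linear form which is a nonzerodivisor modulo `J`. -/
noncomputable def cone {J : Ideal R} (F : FreeRes J) (z : R) (hz : IsHomog z 1)
    (hJ : ∀ p, z * p ∈ J → p ∈ J) : FreeRes (J ⊔ Ideal.span {z}) where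
  ι
    | 0 => F.ι 0
    | i + 1 => F.ι (i + 1) ⊕ F.ι i
  finite
    | 0 => F.finite 0
    | i + 1 => inferInstanceAs (Finite (F.ι (i + 1) ⊕ F.ι i))
  shift
    | 0 => F.shift 0
    | i + 1 => Sum.elim (F.shift (i + 1)) (fun a => F.shift i a + 1)
  d
    | 0 => rowMap (F.d 0) (z • LinearMap.id)
    -- The sign makes the two terms `z • d` cancel in the square of the differential.
    | i + 1 => triMap (F.d (i + 1)) (z • LinearMap.id) (-F.d i)
  e := F.e
  graded_d
    | 0 => (F.graded_d 0).rowMap ((isGraded_id _).smul hz)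
    | i + 1 => (F.graded_d (i + 1)).triMap ((isGraded_id _).smul hz) (F.graded_d i).add_one.neg
  graded_e := F.graded_e
  surj q := (F.surj q).imp fun _ h => Ideal.mem_sup_left h
  exact_e v := by
    constructor
    · intro h
      obtain ⟨j, hj, y, hy, h⟩ := Submodule.mem_sup.mp h
      obtain ⟨q, rfl⟩ := Ideal.mem_span_singleton.mp hy
      obtain ⟨w, hw⟩ := F.surj q
      -- Modulo `J` the value `F.e v` is `z * q`, and `w` lifts `q`, so `z • w` removes the multiple
      -- of `z`.
      have h1 : F.e (v - z • w) () ∈ J := by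
        have := J.add_mem hj (J.mul_mem_left z hw)
        rw [mul_sub, ← add_sub_assoc, h] at this
        simpa using this
      obtain ⟨u, hu⟩ := (F.exact_e _).mp h1
      exact ⟨Sum.elim u w, by rw [rowMap_apply]; simp [hu]⟩
    · rintro ⟨w, rfl⟩
      rw [rowMap_apply, map_add, Pi.add_apply]
      refine Submodule.add_mem_sup (F.e_d _) (Ideal.mem_span_singleton.mpr ?_)
      simp
  exact_d
    | 0 => by
      intro v
      constructor
      · intro h
        change rowMap _ _ v = 0 at h
        rw [rowMap_apply, LinearMap.smul_apply, LinearMap.id_apply] at h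
        have h1 : F.e (v ∘ Sum.inr) () ∈ J := by
          refine hJ _ ?_
          have h2 := congrFun (congrArg F.e h) ()
          simp only [map_add, map_smul, map_zero, Pi.add_apply, Pi.smul_apply, Pi.zero_apply,
            smul_eq_mul] at h2
          rw [eq_neg_of_add_eq_zero_right h2]
          exact J.neg_mem (F.e_d _)
        obtain ⟨w, hw⟩ := (F.exact_e _).mp h1
        have h3 : F.d 0 (v ∘ Sum.inl + z • w) = 0 := by rw [map_add, map_smul, hw, h]
        obtain ⟨u, hu⟩ := (F.exact_d 0 _).mp h3
        refine ⟨Sum.elim u (-w), ?_⟩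
        change triMap _ _ _ _ = v
        rw [triMap_apply]
        ext1 (a | a)
        · simp [hu]
        · simpa using congrFun hw a
      · rintro ⟨w, rfl⟩
        change rowMap _ _ (triMap _ _ _ _) = 0
        rw [rowMap_apply, triMap_apply]
        simp [d_d]
    | i + 1 => by
      intro v
      constructor
      · intro h
        change triMap _ _ _ v = 0 at h
        rw [triMap_apply, LinearMap.smul_apply, LinearMap.id_apply] at h
        have h1 : F.d (i + 1) (v ∘ Sum.inl) + z • (v ∘ Sum.inr) = 0 :=
          funext fun a => congrFun h (Sum.inl a)
        have h2 : F.d i (v ∘ Sum.inr) = 0 :=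
          neg_eq_zero.mp (funext fun a => congrFun h (Sum.inr a))
        obtain ⟨w, hw⟩ := (F.exact_d i _).mp h2
        have h3 : F.d (i + 1) (v ∘ Sum.inl + z • w) = 0 := by rw [map_add, map_smul, hw, h1]
        obtain ⟨u, hu⟩ := (F.exact_d (i + 1) _).mp h3
        refine ⟨Sum.elim u (-w), ?_⟩
        change triMap _ _ _ _ = v
        rw [triMap_apply]
        ext1 (a | a)
        · simp [hu]
        · simpa using congrFun hw a
      · rintro ⟨w, rfl⟩
        change triMap _ _ _ (triMap _ _ _ _) = 0
        rw [triMap_apply, triMap_apply]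
        ext1 (a | a) <;> simp [d_d]

/-- These are the off-diagonal blocks of the horseshoe differential. The last two conclusions say
exactly that the augmentation kills boundaries modulo `I` and that the differential squares to zero.
-/
theorem exists_connecting {I I' I'' : Ideal R} (hI : IsHomogIdeal I) {x : R} (hx : IsHomog x 1)
    (hI' : ∀ p, p ∈ I' ↔ x * p ∈ I) (hI'' : I'' = I ⊔ Ideal.span {x})
    (F' : FreeRes I') (F'' : FreeRes I'') :
    ∃ τ : ∀ i, (F''.ι (i + 1) → R) →ₗ[R] (F'.ι i → R),
      (∀ i, IsGraded (F''.shift (i + 1)) (fun a => F'.shift i a + 1) (τ i)) ∧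
      (∀ v, x * F'.e (τ 0 v) () + F''.e (F''.d 0 v) () ∈ I) ∧
      ∀ i v, F'.d i (τ (i + 1) v) + τ i (F''.d (i + 1) v) = 0 := by
  classical
  obtain ⟨τ₀, hg, h₀⟩ := exists_graded_map (F''.shift 1) (fun a => F'.shift 0 a + 1)
    (P := fun a v => x * F'.e v () + F''.e (F''.d 0 (Pi.single a 1)) () ∈ I)
    (fun a => by
      have h := F''.e_d (Pi.single a 1)
      generalize F''.e (F''.d 0 (Pi.single a 1)) () = p at h
      rw [hI''] at h
      obtain ⟨j, hj, y, hy, rfl⟩ := Submodule.mem_sup.mp h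
      obtain ⟨q, rfl⟩ := Ideal.mem_span_singleton.mp hy
      obtain ⟨w, hw⟩ := F'.surj q
      -- The boundary is `j + x * q` with `j ∈ I`, and `w` lifts `q` modulo `I'`, so `x * F'.e (-w)`
      -- cancels `x * q` modulo `I`.
      refine ⟨-w, ?_⟩
      have := I.add_mem ((hI' _).mp hw) hj
      simp only [map_neg, Pi.neg_apply]
      convert this using 1
      ring)
    (fun a v h => by
      have h1 := hI _ h (F''.shift 1 a)
      rw [map_add, ← e_vecComp, ← F''.graded_d, vecComp_single, mul_comm, homogComp_mul hx,
        ← e_vecComp, mul_comm] at h1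
      rwa [vecComp_add_one])
  have h₀' : ∀ v, x * F'.e (τ₀ v) () + F''.e (F''.d 0 v) () ∈ I := by
    intro v
    have := Fintype.ofFinite (F''.ι 1)
    rw [pi_eq_sum_univ' v]
    simp only [map_sum, map_smul, Finset.sum_apply, Pi.smul_apply, Finset.mul_sum,
      ← Finset.sum_add_distrib, mul_smul_comm, ← smul_add]
    exact I.sum_mem fun a _ => I.mul_mem_left _ (h₀ a)
  obtain ⟨τ, h0, hP, hQ⟩ := exists_dependent_seq
    (α := fun i => (F''.ι (i + 1) → R) →ₗ[R] (F'.ι i → R))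
    (P := fun i τ => IsGraded (F''.shift (i + 1)) (fun a => F'.shift i a + 1) τ ∧
      ∀ v, τ (F''.d (i + 1) v) ∈ LinearMap.range (F'.d i))
    (Q := fun i τ τ' => ∀ v, F'.d i (τ' v) + τ (F''.d (i + 1) v) = 0) τ₀
    ⟨hg, fun v => by
      have := h₀' (F''.d 1 v)
      rw [d_d, map_zero, Pi.zero_apply, add_zero, ← hI'] at this
      exact (F'.exact_e _).mp this⟩
    (fun i τ ⟨h1, h2⟩ => by
      obtain ⟨k, hk, hk'⟩ := exists_graded_lift (h1.comp (F''.graded_d (i + 1))).neg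
        (F'.graded_d i).add_one (fun v => neg_mem (h2 v))
      refine ⟨k, ⟨hk, fun v => ?_⟩, fun v => by simp [hk']⟩
      refine (F'.exact_d i _).mp ?_
      rw [hk']
      simp [d_d])
  exact ⟨τ, fun i => (hP i).1, by rw [h0]; exact h₀', hQ⟩

/-- The horseshoe resolution of the extension `0 → R/(I : x)(-1) → R/I → R/(I + (x)) → 0`. -/
noncomputable def horseshoe {I I' I'' : Ideal R} {x : R} (hx : IsHomog x 1)
    (hI' : ∀ p, p ∈ I' ↔ x * p ∈ I) (hI'' : I'' = I ⊔ Ideal.span {x})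
    (F' : FreeRes I') (F'' : FreeRes I'') (τ : ∀ i, (F''.ι (i + 1) → R) →ₗ[R] (F'.ι i → R))
    (hg : ∀ i, IsGraded (F''.shift (i + 1)) (fun a => F'.shift i a + 1) (τ i))
    (h₀ : ∀ v, x * F'.e (τ 0 v) () + F''.e (F''.d 0 v) () ∈ I)
    (h : ∀ i v, F'.d i (τ (i + 1) v) + τ i (F''.d (i + 1) v) = 0) : FreeRes I where
  ι i := F'.ι i ⊕ F''.ι i
  finite i := inferInstance
  shift i := Sum.elim (fun a => F'.shift i a + 1) (F''.shift i)
  d i := triMap (F'.d i) (τ i) (F''.d i)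
  e := rowMap (x • F'.e) F''.e
  graded_d i := (F'.graded_d i).add_one.triMap (hg i) (F''.graded_d i)
  graded_e := (F'.graded_e.smul hx).rowMap F''.graded_e
  surj q := by
    obtain ⟨w, hw⟩ := F''.surj q
    replace hw := hI''.le hw
    obtain ⟨j, hj, y, hy, hw⟩ := Submodule.mem_sup.mp hw
    obtain ⟨p, rfl⟩ := Ideal.mem_span_singleton.mp hy
    obtain ⟨u, hu⟩ := F'.surj p
    refine ⟨Sum.elim u w, ?_⟩
    have := I.add_mem ((hI' _).mp hu) hj
    rw [rowMap_apply]
    simp only [Sum.elim_comp_inl, Sum.elim_comp_inr, Pi.add_apply, LinearMap.smul_apply,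
      Pi.smul_apply, smul_eq_mul]
    convert this using 1
    linear_combination -hw
  exact_e v := by
    rw [rowMap_apply]
    simp only [Pi.add_apply, LinearMap.smul_apply, Pi.smul_apply, smul_eq_mul]
    constructor
    · intro hv
      have h1 : F''.e (v ∘ Sum.inr) () ∈ I'' := by
        refine hI''.ge ((Submodule.add_mem_iff_right _ ?_).mp (Ideal.mem_sup_left hv))
        exact Ideal.mem_sup_right (Ideal.mul_mem_right _ _ (Ideal.mem_span_singleton_self x))
      obtain ⟨w, hw⟩ := (F''.exact_e _).mp h1
      -- A boundary whose second block is `F''.d 0 w` has first block `τ 0 w` up to the range of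
      -- `F'.d 0`; subtracting it leaves a problem about `F'` alone.
      have h2 : F'.e (v ∘ Sum.inl - τ 0 w) () ∈ I' := by
        rw [hI']
        have := I.sub_mem hv (h₀ w)
        rw [← hw] at this
        simp only [map_sub, Pi.sub_apply]
        convert this using 1
        ring
      obtain ⟨u, hu⟩ := (F'.exact_e _).mp h2
      refine ⟨Sum.elim u w, ?_⟩
      rw [triMap_apply]
      ext1 (a | a)
      · simp [hu]
      · simp [hw]
    · rintro ⟨w, rfl⟩
      rw [triMap_apply]
      simp only [Sum.elim_comp_inl, Sum.elim_comp_inr, map_add, Pi.add_apply]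
      have := I.add_mem ((hI' _).mp (F'.e_d (w ∘ Sum.inl))) (h₀ (w ∘ Sum.inr))
      convert this using 1
      ring
  exact_d i v := by
    constructor
    · intro hv
      rw [triMap_apply] at hv
      have h1 : F'.d i (v ∘ Sum.inl) + τ i (v ∘ Sum.inr) = 0 :=
        funext fun a => congrFun hv (Sum.inl a)
      have h2 : F''.d i (v ∘ Sum.inr) = 0 := funext fun a => congrFun hv (Sum.inr a)
      obtain ⟨w, hw⟩ := (F''.exact_d i _).mp h2
      have h3 : F'.d i (v ∘ Sum.inl - τ (i + 1) w) = 0 := by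
        rw [← hw] at h1
        rw [map_sub, eq_neg_of_add_eq_zero_left (h i w), sub_neg_eq_add, h1]
      obtain ⟨u, hu⟩ := (F'.exact_d i _).mp h3
      refine ⟨Sum.elim u w, ?_⟩
      rw [triMap_apply]
      ext1 (a | a)
      · simp [hu]
      · simp [hw]
    · rintro ⟨w, rfl⟩
      rw [triMap_apply, triMap_apply]
      simp only [Sum.elim_comp_inl, Sum.elim_comp_inr, map_add, d_d, zero_add, h]
      exact funext fun a => by cases a <;> rfl

end FreeRes

/-- In the mapping cone the second copy of the resolution moves up by one both in homological degree
and, as `z` is linear, in internal degree, so the bound on shift minus index is unchanged. -/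
theorem RegLE.sup_span {J : Ideal R} {r : ℤ} (h : RegLE J r) {z : R} (hz : IsHomog z 1)
    (hJ : ∀ p, z * p ∈ J → p ∈ J) : RegLE (J ⊔ Ideal.span {z}) r := by
  obtain ⟨F, ⟨g, hg⟩, hF⟩ := h
  refine ⟨F.cone z hz hJ, ⟨g + 1, fun i hi => ?_⟩, fun i a => ?_⟩
  · obtain ⟨i, rfl⟩ := Nat.exists_eq_succ_of_ne_zero (Nat.ne_zero_of_lt hi)
    have := hg (i + 1) (by omega)
    have := hg i (by omega)
    exact inferInstanceAs (IsEmpty (F.ι (i + 1) ⊕ F.ι i))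
  · rcases i with _ | i
    · exact hF 0 a
    · rcases a with a | a
      · exact hF (i + 1) a
      · have := hF i a
        change F.shift i a + 1 ≤ _
        push_cast
        omega

/-- In the horseshoe resolution the colon part keeps its homological degree but is twisted by the
degree of `x`; hence it must satisfy the bound with `r - 1`. -/
theorem RegLE.of_colon_of_sup {I I' I'' : Ideal R} (hI : IsHomogIdeal I) {x : R}
    (hx : IsHomog x 1) (hI' : ∀ p, p ∈ I' ↔ x * p ∈ I) (hI'' : I'' = I ⊔ Ideal.span {x})
    {r : ℤ} (h' : RegLE I' (r - 1)) (h'' : RegLE I'' r) : RegLE I r := by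
  obtain ⟨F', ⟨g', hg'⟩, hF'⟩ := h'
  obtain ⟨F'', ⟨g'', hg''⟩, hF''⟩ := h''
  obtain ⟨τ, hg, h₀, h⟩ := FreeRes.exists_connecting hI hx hI' hI'' F' F''
  refine ⟨FreeRes.horseshoe hx hI' hI'' F' F'' τ hg h₀ h, ⟨max g' g'', fun i hi => ?_⟩, ?_⟩
  · have := hg' i (by omega)
    have := hg'' i (by omega)
    exact inferInstanceAs (IsEmpty (F'.ι i ⊕ F''.ι i))
  · rintro i (a | a)
    · have := hF' i a
      change F'.shift i a + 1 ≤ _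
      omega
    · exact hF'' i a

end Regularity

/-! ### Ideals generated by edges and variables -/

section SquarefreeIdeals

variable {σ : Type*} {K : Type v} [Field K]

theorem mem_span_monomial_iff {S : Set (σ →₀ ℕ)} {p : MvPolynomial σ K} :
    p ∈ Ideal.span ((fun s => monomial s (1 : K)) '' S) ↔ ∀ m ∈ p.support, ∃ s ∈ S, s ≤ m :=
  mem_ideal_span_monomial_image

theorem single_le_iff_ne_zero {x : σ} {m : σ →₀ ℕ} : Finsupp.single x 1 ≤ m ↔ m x ≠ 0 := by
  rw [Finsupp.single_le_iff, Nat.one_le_iff_ne_zero]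

theorem single_add_single_le_iff {x y : σ} (h : x ≠ y) {m : σ →₀ ℕ} :
    Finsupp.single x 1 + Finsupp.single y 1 ≤ m ↔ m x ≠ 0 ∧ m y ≠ 0 := by
  classical
  constructor
  · intro hm
    have hx := hm x
    have hy := hm y
    simp [h, h.symm] at hx hy
    omega
  · rintro ⟨hx, hy⟩ z
    simp only [Finsupp.add_apply, Finsupp.single_apply]
    split_ifs with h1 h2 h2
    · exact absurd (h1.trans h2.symm) h
    · subst h1; omega
    · subst h2; omega
    · omega

variable {V : Type*}

/-- The ideal generated by the edges of a graph, whose vertices are mapped to variables by `f`,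
together with a set of variables. -/
noncomputable def edgeVarIdeal (K : Type v) [Field K] (E : SimpleGraph V) (f : V → σ)
    (Z : Set σ) : Ideal (MvPolynomial σ K) :=
  Ideal.span ((fun s => monomial s (1 : K)) ''
    ({s | ∃ a b, E.Adj a b ∧ s = Finsupp.single (f a) 1 + Finsupp.single (f b) 1} ∪
      {s | ∃ z ∈ Z, s = Finsupp.single z 1}))

/-- Membership in a monomial ideal is tested on each monomial, and squarefree generators see only
which exponents are nonzero. The ideal identities below thereby become combinatorics of supports. -/
theorem mem_edgeVarIdeal {E : SimpleGraph V} {f : V → σ} (hf : Function.Injective f) {Z : Set σ}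
    {p : MvPolynomial σ K} : p ∈ edgeVarIdeal K E f Z ↔
      ∀ m ∈ p.support, (∃ a b, E.Adj a b ∧ m (f a) ≠ 0 ∧ m (f b) ≠ 0) ∨ ∃ z ∈ Z, m z ≠ 0 := by
  rw [edgeVarIdeal, mem_span_monomial_iff]
  refine forall₂_congr fun m _ => ⟨?_, ?_⟩
  · rintro ⟨s, ⟨a, b, hab, rfl⟩ | ⟨z, hz, rfl⟩, h⟩
    · exact Or.inl ⟨a, b, hab, (single_add_single_le_iff (hf.ne hab.ne)).mp h⟩
    · exact Or.inr ⟨z, hz, single_le_iff_ne_zero.mp h⟩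
  · rintro (⟨a, b, hab, h⟩ | ⟨z, hz, h⟩)
    · exact ⟨_, Or.inl ⟨a, b, hab, rfl⟩, (single_add_single_le_iff (hf.ne hab.ne)).mpr h⟩
    · exact ⟨_, Or.inr ⟨z, hz, rfl⟩, single_le_iff_ne_zero.mpr h⟩

theorem isHomogIdeal_edgeVarIdeal (E : SimpleGraph V) (f : V → σ) (Z : Set σ) :
    IsHomogIdeal (edgeVarIdeal K E f Z) := by
  intro p hp n
  rw [edgeVarIdeal, mem_span_monomial_iff] at hp ⊢
  intro m hm
  refine hp m ?_
  rw [mem_support_iff, coeff_homogComp] at hm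
  rw [mem_support_iff]
  exact fun h => hm (by simp [h])

theorem forall_mem_support_X_mul {x : σ} {p : MvPolynomial σ K} {P : (σ →₀ ℕ) → Prop} :
    (∀ m ∈ (X x * p).support, P m) ↔ ∀ m ∈ p.support, P (Finsupp.single x 1 + m) := by
  rw [support_X_mul]
  simp [Finset.mem_map]

theorem edgeVarIdeal_insert (E : SimpleGraph V) (f : V → σ) (Z : Set σ) (x : σ) :
    edgeVarIdeal K E f (insert x Z) = edgeVarIdeal K E f Z ⊔ Ideal.span {X x} := by
  have : (X x : MvPolynomial σ K) = monomial (Finsupp.single x 1) 1 := rfl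
  rw [this, edgeVarIdeal, edgeVarIdeal, ← Ideal.span_union,
    ← Set.image_singleton (f := fun s => monomial s (1 : K)), ← Set.image_union]
  congr 2
  ext s
  simp only [Set.mem_union, Set.mem_ofPred_eq, Set.mem_insert_iff, Set.mem_singleton_iff]
  constructor
  · rintro (h | ⟨z, rfl | hz, rfl⟩)
    · exact Or.inl (Or.inl h)
    · exact Or.inr rfl
    · exact Or.inl (Or.inr ⟨z, hz, rfl⟩)
  · rintro ((h | ⟨z, hz, rfl⟩) | rfl)
    · exact Or.inl h
    · exact Or.inr ⟨z, Or.inr hz, rfl⟩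
    · exact Or.inr ⟨x, Or.inl rfl, rfl⟩

theorem isHomog_X (x : σ) : IsHomog (X x : MvPolynomial σ K) 1 :=
  isWeightedHomogeneous_X K _ x

theorem single_add_ne_zero_iff {x y : σ} {m : σ →₀ ℕ} :
    (Finsupp.single x 1 + m : σ →₀ ℕ) y ≠ 0 ↔ y = x ∨ m y ≠ 0 := by
  classical
  rw [Finsupp.add_apply, Finsupp.single_apply]
  by_cases h : x = y
  · simp [h]
  · simp [h, Ne.symm h]

/-- Each new variable is a nonzerodivisor modulo the previous ones; the iterated cones form a Koszul
complex. -/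
theorem regLE_variables {f : V → σ} (hf : Function.Injective f) {Z : Set σ} (hZ : Z.Finite) :
    RegLE (edgeVarIdeal K ⊥ f Z) 0 := by
  induction Z, hZ using Set.Finite.induction_on with
  | empty =>
    have : edgeVarIdeal K ⊥ f ∅ = ⊥ := by simp [edgeVarIdeal]
    rw [this]
    exact RegLE.bot
  | @insert x Z hx _ ih =>
    rw [edgeVarIdeal_insert]
    refine ih.sup_span (isHomog_X x) fun p hp => ?_
    rw [mem_edgeVarIdeal hf, forall_mem_support_X_mul] at hp
    rw [mem_edgeVarIdeal hf]
    intro m hm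
    obtain ⟨a, b, hab, -⟩ | ⟨z, hz, h⟩ := hp m hm
    · exact hab.elim
    · exact Or.inr ⟨z, hz, (single_add_ne_zero_iff.mp h).resolve_left fun h' => hx (h' ▸ hz)⟩

theorem edgeVarIdeal_sup_X (E : SimpleGraph V) {f : V → σ} (hf : Function.Injective f)
    (Z : Set σ) (x : V) {A : Set V} (hA : A = {x}) :
    edgeVarIdeal K (E.induce Aᶜ) (f ∘ Subtype.val) (insert (f x) Z) =
      edgeVarIdeal K E f Z ⊔ Ideal.span {X (f x)} := by
  subst hA
  rw [← edgeVarIdeal_insert]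
  ext p
  rw [mem_edgeVarIdeal (hf.comp Subtype.val_injective), mem_edgeVarIdeal hf]
  refine forall₂_congr fun m _ => ⟨?_, ?_⟩
  · rintro (⟨a, b, hab, h⟩ | h)
    · exact Or.inl ⟨a, b, hab, h⟩
    · exact Or.inr h
  · rintro (⟨a, b, hab, ha, hb⟩ | h)
    · by_cases hax : a = x
      · exact Or.inr ⟨f x, Or.inl rfl, hax ▸ ha⟩
      by_cases hbx : b = x
      · exact Or.inr ⟨f x, Or.inl rfl, hbx ▸ hb⟩
      exact Or.inl ⟨⟨a, hax⟩, ⟨b, hbx⟩, hab, ha, hb⟩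
    · exact Or.inr h

/-- Dividing by `x` turns an edge `xy` into the variable `y`; every other edge meeting `N(x)` then
becomes redundant. If `f x` lay in `Z`, the colon would be the whole ring. -/
theorem mem_edgeVarIdeal_colon_X (E : SimpleGraph V) {f : V → σ} (hf : Function.Injective f)
    {Z : Set σ} {x : V} (hx : f x ∉ Z) (p : MvPolynomial σ K) :
    p ∈ edgeVarIdeal K (E.induce ({x} ∪ E.neighborSet x)ᶜ) (f ∘ Subtype.val)
      (Z ∪ f '' E.neighborSet x) ↔ X (f x) * p ∈ edgeVarIdeal K E f Z := by
  rw [mem_edgeVarIdeal (hf.comp Subtype.val_injective), mem_edgeVarIdeal hf,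
    forall_mem_support_X_mul]
  refine forall₂_congr fun m _ => ?_
  simp only [single_add_ne_zero_iff]
  constructor
  · rintro (⟨a, b, hab, ha, hb⟩ | ⟨_, hz | ⟨y, hy, rfl⟩, h⟩)
    · exact Or.inl ⟨a, b, hab, Or.inr ha, Or.inr hb⟩
    · exact Or.inr ⟨_, hz, Or.inr h⟩
    · exact Or.inl ⟨x, y, hy, Or.inl rfl, Or.inr h⟩
  · rintro (⟨a, b, hab, ha, hb⟩ | ⟨z, hz, h⟩)
    · by_cases hax : a = x
      · subst hax
        exact Or.inr ⟨f b, Or.inr ⟨b, hab, rfl⟩, hb.resolve_left (hf.ne hab.ne')⟩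
      by_cases hbx : b = x
      · subst hbx
        exact Or.inr ⟨f a, Or.inr ⟨a, hab.symm, rfl⟩, ha.resolve_left (hf.ne hab.ne)⟩
      have ha := ha.resolve_left (hf.ne hax)
      have hb := hb.resolve_left (hf.ne hbx)
      by_cases hxa : E.Adj x a
      · exact Or.inr ⟨f a, Or.inr ⟨a, hxa, rfl⟩, ha⟩
      by_cases hxb : E.Adj x b
      · exact Or.inr ⟨f b, Or.inr ⟨b, hxb, rfl⟩, hb⟩
      exact Or.inl ⟨⟨a, by simp [hax, hxa]⟩, ⟨b, by simp [hbx, hxb]⟩, hab, ha, hb⟩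
    · exact Or.inr ⟨z, Or.inl hz, h.resolve_left fun h => hx (h ▸ hz)⟩

end SquarefreeIdeals

/-! ### Edge ideals and the induction on vertices -/

theorem FinGraph.edgeIdeal_eq (K : Type v) [Field K] (G : FinGraph.{u}) :
    G.edgeIdeal K = edgeVarIdeal K G.graph id ∅ := by
  rw [edgeIdeal, edgeVarIdeal]
  congr 1
  ext p
  constructor
  · rintro ⟨a, b, hab, rfl⟩
    exact ⟨_, Or.inl ⟨a, b, hab, rfl⟩, by simp [X, monomial_mul]⟩
  · rintro ⟨_, ⟨a, b, hab, rfl⟩ | ⟨z, hz, rfl⟩, rfl⟩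
    · exact ⟨a, b, hab, by simp [X, monomial_mul]⟩
    · exact hz.elim

/-- Deleting vertices would shrink the polynomial ring. Instead the ring on `σ` stays fixed, `f`
embeds the surviving vertices, and `Z` collects variables added to the ideal; disjointness of `Z`
from the image of `f` is preserved in both branches. -/
theorem regLE_edgeVarIdeal (K : Type v) [Field K] {σ : Type*} [Finite σ]
    (𝓕 : Set FinGraph.{u}) (β : 𝓕 → ℕ)
    (hβ : ∀ G : 𝓕, G.1.IsDiscrete → β G = 0)
    (hvertex : ∀ G : 𝓕, G.1.graph.edgeSet.Nonempty → ∃ x : G.1.V,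
      ∃ (h₁ : G.1.delete {x} ∈ 𝓕) (h₂ : G.1.delete ({x} ∪ G.1.graph.neighborSet x) ∈ 𝓕),
        β ⟨_, h₂⟩ < β G ∧ β ⟨_, h₁⟩ ≤ β G) (n : ℕ) (G : 𝓕) (hn : Nat.card G.1.V = n)
    (f : G.1.V → σ) (hf : Function.Injective f) (Z : Set σ) (hZ : ∀ a, f a ∉ Z) :
    RegLE (edgeVarIdeal K G.1.graph f Z) (β G) := by
  induction n using Nat.strong_induction_on generalizing G Z with
  | _ n ih =>
    have := G.1.finite
    rcases G.1.graph.edgeSet.eq_empty_or_nonempty with hG | hG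
    · rw [hβ G hG, SimpleGraph.edgeSet_eq_empty.mp hG]
      exact regLE_variables hf Z.toFinite
    · obtain ⟨x, h₁, h₂, hβ₂, hβ₁⟩ := hvertex G hG
      have hcard : ∀ A : Set G.1.V, x ∈ A → Nat.card (G.1.delete A).V < n := fun A hA => by
        rw [← hn]
        exact Finite.card_subtype_lt (x := x) (p := fun y => y ∈ Aᶜ) (fun h => h hA)
      refine RegLE.of_colon_of_sup (isHomogIdeal_edgeVarIdeal _ _ _) (isHomog_X (f x))
        (mem_edgeVarIdeal_colon_X G.1.graph hf (hZ x)) (edgeVarIdeal_sup_X G.1.graph hf Z x rfl)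
        ?_ ?_
      -- The strict inequality for `β` supplies the bound `β G - 1` needed for the colon ideal.
      · refine (ih _ (hcard _ (Or.inl rfl)) ⟨_, h₂⟩ rfl (f ∘ Subtype.val)
          (hf.comp Subtype.val_injective) _ ?_).mono (by omega)
        rintro ⟨a, ha⟩ (h | ⟨y, hy, h⟩)
        · exact hZ a h
        · obtain rfl : y = a := hf h
          exact ha (Or.inr hy)
      · refine (ih _ (hcard {x} rfl) ⟨_, h₁⟩ rfl (f ∘ Subtype.val)
          (hf.comp Subtype.val_injective) _ ?_).mono (by omega)
        rintro ⟨a, ha⟩ (h | h)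
        · exact ha (hf h)
        · exact hZ a h

/-! ### Existence of minimal resolutions and passage to regularity -/

section MinimalResolutions

variable {σ : Type u} {K : Type v} [Field K]

local notation "R" => MvPolynomial σ K

theorem exists_homogeneous_generators [Finite σ] {n : ℕ} {s : Fin n → ℤ}
    {N : Submodule R (Fin n → R)} (hN : ∀ v ∈ N, ∀ k, vecComp s k v ∈ N) :
    ∃ (m : ℕ) (t : Fin m → ℤ) (w : Fin m → Fin n → R),
      (∀ a, vecComp s (t a) (w a) = w a) ∧ Submodule.span R (Set.range w) = N := by
  obtain ⟨S, hS⟩ := IsNoetherian.noetherian N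
  choose T hT using fun v : Fin n → R => exists_sum_vecComp s v
  let e := Finite.equivFin (Σ g : S, T g.1)
  let w : (Σ g : S, T g.1) → Fin n → R := fun a => vecComp s a.2.1 a.1.1
  refine ⟨_, fun a => (e.symm a).2.1, w ∘ e.symm, fun a => vecComp_vecComp _ _ _, ?_⟩
  rw [e.symm.surjective.range_comp]
  refine le_antisymm (Submodule.span_le.mpr ?_) ?_
  · rintro _ ⟨⟨g, k⟩, rfl⟩
    exact hN _ (hS ▸ Submodule.subset_span g.2) _
  · rw [← hS, Submodule.span_le]
    intro g hg
    rw [← hT g]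
    exact Submodule.sum_mem _ fun k hk => Submodule.subset_span ⟨⟨⟨g, hg⟩, ⟨k, hk⟩⟩, rfl⟩

/-- Graded Nakayama: take homogeneous generators in the least possible number. A relation with a
nonzero constant coefficient would make one of them redundant. -/
theorem exists_minimal_cover [Finite σ] {n : ℕ} {s : Fin n → ℤ}
    {N : Submodule R (Fin n → R)} (hN : ∀ v ∈ N, ∀ k, vecComp s k v ∈ N) :
    ∃ (m : ℕ) (t : Fin m → ℤ) (f : (Fin m → R) →ₗ[R] (Fin n → R)),
      IsGraded t s f ∧ LinearMap.range f = N ∧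
        ∀ v, f v = 0 → ∀ a, constantCoeff (v a) = 0 := by
  classical
  have hex := exists_homogeneous_generators hN
  obtain ⟨t, w, hw, hspan⟩ := Nat.find_spec hex
  have hmin := fun k => Nat.find_min hex (m := k)
  generalize Nat.find hex = m at *
  have hgr : IsGraded t s (Fintype.linearCombination R w) :=
    isGraded_of_single fun a => by
      rw [Fintype.linearCombination_apply_single, one_smul, hw]
  refine ⟨m, t, Fintype.linearCombination R w, hgr,
    (Fintype.range_linearCombination R w).trans hspan, fun v hv a => ?_⟩
  by_contra hc
  obtain ⟨m, rfl⟩ : ∃ k, m = k + 1 := ⟨m - 1, by have := a.pos; omega⟩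
  refine hmin m m.lt_succ_self ⟨t ∘ a.succAbove, w ∘ a.succAbove, fun b => hw _, ?_⟩
  -- In the component of degree `t a` of the relation, the coefficient of `w a` is the constant term
  -- of `v a`, a unit by `hc`.
  have h1 := hgr (t a) v
  rw [hv, map_zero, Fintype.linearCombination_apply, Fin.sum_univ_succAbove _ a, vecComp_apply,
    sub_self, homogComp_zero_eq] at h1
  have h2 : w a ∈ Submodule.span R (Set.range (w ∘ a.succAbove)) := by
    have h3 : (C (constantCoeff (v a)) : R) • w a ∈ Submodule.span R (Set.range (w ∘ a.succAbove)) := by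
      rw [eq_neg_of_add_eq_zero_left h1]
      exact neg_mem (Submodule.sum_mem _ fun b _ =>
        Submodule.smul_mem _ _ (Submodule.subset_span ⟨b, rfl⟩))
    have h4 := Submodule.smul_mem _ (C (constantCoeff (v a))⁻¹ : R) h3
    rwa [smul_smul, ← C_mul, inv_mul_cancel₀ hc, C_1, one_smul] at h4
  rw [← hspan]
  refine le_antisymm (Submodule.span_mono (Set.range_comp_subset_range _ _))
    (Submodule.span_le.mpr ?_)
  rintro _ ⟨b, rfl⟩
  by_cases hb : b = a
  · exact hb ▸ h2
  · obtain ⟨b, rfl⟩ := Fin.exists_succAbove_eq hb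
    exact Submodule.subset_span ⟨b, rfl⟩

variable (σ K) in
/-- A graded free module with a graded submodule contained in its product with the ideal generated
by the variables. -/
structure SyzygyStage where
  n : ℕ
  s : Fin n → ℤ
  N : Submodule R (Fin n → R)
  graded : ∀ v ∈ N, ∀ k, vecComp s k v ∈ N
  minimal : ∀ v ∈ N, ∀ a, constantCoeff (v a) = 0

theorem SyzygyStage.exists_next [Finite σ] (S : SyzygyStage σ K) :
    ∃ (T : SyzygyStage σ K) (f : (Fin T.n → R) →ₗ[R] (Fin S.n → R)),
      IsGraded T.s S.s f ∧ LinearMap.range f = S.N ∧ LinearMap.ker f = T.N := by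
  obtain ⟨m, t, f, hf, hr, hm⟩ := exists_minimal_cover S.graded
  refine ⟨⟨m, t, LinearMap.ker f, fun v hv k => ?_, fun v hv => hm v hv⟩, f, hf, hr, rfl⟩
  rw [LinearMap.mem_ker] at hv ⊢
  rw [hf, hv, map_zero]

/-- The ideal `I` as a submodule of the free module of rank one. -/
noncomputable def SyzygyStage.ofIdeal {I : Ideal R} (hI : IsHomogIdeal I)
    (hI₀ : ∀ p ∈ I, constantCoeff p = 0) : SyzygyStage σ K where
  n := 1
  s := 0
  N := Submodule.comap (LinearMap.proj 0) I
  graded v hv k := by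
    have := hI _ hv (k - 0)
    exact this
  minimal v hv a := by
    rw [Subsingleton.elim a 0]
    exact hI₀ _ hv

/-- Minimal covers of successive syzygy modules are spliced, starting from `I` inside `R`. The
hypothesis `hI₀` makes the first differential minimal. Finite length is not claimed here. -/
theorem exists_minimal_freeRes [Finite σ] {I : Ideal R} (hI : IsHomogIdeal I)
    (hI₀ : ∀ p ∈ I, constantCoeff p = 0) :
    ∃ (rank : ℕ → ℕ) (F : FreeRes I), F.ι = (fun i => Fin (rank i)) ∧ F.IsMin ∧
      Nonempty (F.ι 0) := by
  choose next f hf hr hk using SyzygyStage.exists_next (σ := σ) (K := K)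
  let S : ℕ → SyzygyStage σ K := fun i => Nat.rec (SyzygyStage.ofIdeal hI hI₀) (fun _ => next) i
  refine ⟨fun i => (S i).n, ⟨fun i => Fin (S i).n, fun _ => inferInstance, fun i => (S i).s,
    fun i => f (S i), LinearMap.pi fun _ => LinearMap.proj (0 : Fin 1), fun i => hf (S i),
    fun n v => rfl, fun q => ⟨fun _ => q, ?_⟩, fun v => ?_, fun i v => ?_⟩, rfl,
    fun i v => ?_, ⟨(0 : Fin 1)⟩⟩
  · exact (sub_self q).symm ▸ I.zero_mem
  · rw [hr]; rfl
  · rw [← LinearMap.mem_ker, hk, ← LinearMap.coe_range, hr]; rfl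
  · exact (S i).minimal _ (hr (S i) ▸ ⟨v, rfl⟩)

theorem mem_span_range_X_iff {p : R} :
    p ∈ Ideal.span (Set.range (X : σ → R)) ↔ constantCoeff p = 0 := by
  rw [← Set.image_univ, mem_ideal_span_X_image, constantCoeff_eq, ← notMem_support_iff]
  constructor
  · intro h h0
    obtain ⟨i, -, hi⟩ := h 0 h0
    exact hi rfl
  · intro h m hm
    by_contra! h'
    refine h ?_
    rwa [show (0 : σ →₀ ℕ) = m from Finsupp.ext fun i => (h' i trivial).symm]

theorem mem_span_range_X_smul_top_iff {n : ℕ} {v : Fin n → R} :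
    v ∈ (Ideal.span (Set.range (X : σ → R))) • (⊤ : Submodule R (Fin n → R)) ↔
      ∀ a, constantCoeff (v a) = 0 := by
  constructor
  · intro h a
    induction h using Submodule.smul_induction_on' with
    | smul r hr w _ => simp [mem_span_range_X_iff.mp hr]
    | add x _ y _ hx hy => simp [hx, hy]
  · intro h
    rw [pi_eq_sum_univ' v]
    exact Submodule.sum_mem _ fun a _ =>
      Submodule.smul_mem_smul (mem_span_range_X_iff.mpr (h a)) trivial

namespace GradedFreeResolution

variable {I : Ideal (MvPolynomial σ K)}

theorem isMinimal_iff (F : GradedFreeResolution I) :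
    F.IsMinimal ↔ ∀ i v b, constantCoeff (F.d i v b) = 0 := by
  refine forall_congr' fun i => ⟨fun h v => ?_, ?_⟩
  · exact mem_span_range_X_smul_top_iff.mp (h ⟨v, rfl⟩)
  · rintro h _ ⟨v, rfl⟩
    exact mem_span_range_X_smul_top_iff.mpr (h v)

theorem betti_eq (F : GradedFreeResolution I) (i : ℕ) (j : ℤ) :
    F.betti i j = Nat.card {a // F.shift i a = j} := by
  rw [betti, Nat.card_eq_fintype_card, Fintype.card_subtype]

theorem exists_freeRes (F : GradedFreeResolution I) (hF : F.IsMinimal) :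
    ∃ F' : FreeRes I, F'.IsMin ∧ ∀ i j, F.betti i j = Nat.card {a // F'.shift i a = j} := by
  choose p hp hε using F.ε_degree
  let e : (Fin (F.rank 0) → R) →ₗ[R] (Unit → R) := Fintype.linearCombination R fun a _ => p a
  have he : ∀ v, Ideal.Quotient.mk I (e v ()) = F.ε v := fun v => by
    conv_rhs => rw [pi_eq_sum_univ' v, map_sum]
    simp only [e, Fintype.linearCombination_apply, Finset.sum_apply, Pi.smul_apply, map_sum,
      map_smul]
    refine Finset.sum_congr rfl fun a _ => ?_
    rw [hε]
    rfl
  refine ⟨⟨fun i => Fin (F.rank i), fun _ => inferInstance, F.shift, F.d, e,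
    fun i => isGraded_of_single fun a => vecComp_eq_self_iff.mpr fun b =>
      hasIntDegree_iff.mp (F.d_degree i a b),
    isGraded_of_single fun a => vecComp_eq_self_iff.mpr fun b => ?_,
    fun q => ?_, fun v => ?_, F.exact_succ⟩, F.isMinimal_iff.mp hF, F.betti_eq⟩
  · rw [Fintype.linearCombination_apply_single, one_smul]
    simpa using hasIntDegree_iff.mp (hp a)
  · obtain ⟨v, hv⟩ := F.ε_surjective (Ideal.Quotient.mk I q)
    exact ⟨v, by rw [← Ideal.Quotient.eq, he, hv]⟩
  · rw [← Ideal.Quotient.eq_zero_iff_mem, he]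
    exact F.exact_zero v

theorem exists_of_freeRes (F : FreeRes I) {rank : ℕ → ℕ} (hrank : F.ι = fun i => Fin (rank i))
    (hF : F.IsMin) (hfin : ∃ g, ∀ i, g < i → IsEmpty (F.ι i)) :
    ∃ F' : GradedFreeResolution I, F'.IsMinimal := by
  obtain ⟨ι, finite, shift, d, e, gd, ge, surj, exe, exd⟩ := F
  obtain rfl : ι = fun i => Fin (rank i) := hrank
  obtain ⟨g, hg⟩ := hfin
  refine ⟨⟨rank, shift, d, (Ideal.Quotient.mkₐ R I).toLinearMap ∘ₗ LinearMap.proj () ∘ₗ e,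
    ⟨g, fun i hi => ?_⟩, fun i a b => ?_, fun a => ⟨e (Pi.single a 1) (), ?_, rfl⟩, ?_, ?_,
    exd⟩, (isMinimal_iff _).mpr hF⟩
  · by_contra h
    exact (hg i hi).false ⟨0, Nat.pos_of_ne_zero h⟩
  · exact hasIntDegree_iff.mpr (vecComp_eq_self_iff.mp ((gd i).single a) b)
  · rw [hasIntDegree_iff]
    simpa using vecComp_eq_self_iff.mp (ge.single a) ()
  · intro q
    obtain ⟨q, rfl⟩ := Ideal.Quotient.mk_surjective q
    obtain ⟨v, hv⟩ := surj q
    exact ⟨v, (Ideal.Quotient.eq.mpr hv).symm⟩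
  · intro v
    refine Iff.trans ?_ (exe v)
    exact Ideal.Quotient.eq_zero_iff_mem

end GradedFreeResolution

/-- Every degree occurring in the minimal resolution `M` occurs in the given one, at the same
homological position. So `M` inherits both the bound `r₀` and finite length, and the maximum exists;
it is the same for every minimal resolution by comparison in both directions. -/
theorem RegLE.exists_hasRegularity [Finite σ] {I : Ideal R} (hI : IsHomogIdeal I)
    (hI₀ : ∀ p ∈ I, constantCoeff p = 0) {r₀ : ℤ} (h : RegLE I r₀) :
    ∃ r : ℤ, HasRegularity I r ∧ r ≤ r₀ := by
  obtain ⟨G, ⟨g, hg⟩, hG⟩ := h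
  obtain ⟨rank, M, hrank, hM, ⟨a₀⟩⟩ := exists_minimal_freeRes hI hI₀
  have hcard : ∀ i j, Nat.card {a // M.shift i a = j} ≠ 0 → ∃ b, G.shift i b = j := by
    intro i j hij
    have h1 := M.card_shift_le hI G hM i j
    have h2 : Nat.card {b // G.shift i b = j} ≠ 0 := by omega
    obtain ⟨⟨b, hb⟩⟩ := (Nat.card_ne_zero.mp h2).1
    exact ⟨b, hb⟩
  have hpos : ∀ i a, Nat.card {b // M.shift i b = M.shift i a} ≠ 0 := fun i a =>
    Nat.card_ne_zero.mpr ⟨⟨a, rfl⟩, inferInstance⟩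
  obtain ⟨r, hr, hr'⟩ := Int.exists_greatest_of_bdd
    (P := fun n => ∃ (i : ℕ) (j : ℤ), Nat.card {a // M.shift i a = j} ≠ 0 ∧ n = j - i)
    ⟨r₀, by
      rintro _ ⟨i, j, hij, rfl⟩
      obtain ⟨b, rfl⟩ := hcard i j hij
      have := hG i b
      -- The module in homological degree zero is nonzero, so the set of values `j - i` is nonempty.
      omega⟩ ⟨_, 0, _, hpos 0 a₀, rfl⟩
  refine ⟨r, ⟨?_, fun F hF => ?_⟩, ?_⟩
  · refine GradedFreeResolution.exists_of_freeRes M hrank hM ⟨g, fun i hi => ⟨fun a => ?_⟩⟩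
    obtain ⟨b, -⟩ := hcard i _ (hpos i a)
    exact (hg i hi).false b
  · obtain ⟨F', hF', hb⟩ := F.exists_freeRes hF
    have : ∀ i j, F.betti i j = Nat.card {a // M.shift i a = j} := fun i j =>
      (hb i j).trans (le_antisymm (F'.card_shift_le hI M hF' i j) (M.card_shift_le hI F' hM i j))
    simp only [this]
    exact ⟨hr, fun n hn => hr' n hn⟩
  · obtain ⟨i, j, hij, rfl⟩ := hr
    obtain ⟨b, rfl⟩ := hcard i j hij
    have := hG i b
    omega

end MinimalResolutions

theorem theorem3 (K : Type v) [Field K] (𝓕 : Set FinGraph.{u}) (β : 𝓕 → ℕ)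
    (hdiscrete : ∀ G : FinGraph.{u}, G.IsDiscrete → G ∈ 𝓕)
    (hβ : ∀ G : 𝓕, G.1.IsDiscrete → β G = 0)
    (hvertex : ∀ G : 𝓕, G.1.graph.edgeSet.Nonempty → ∃ x : G.1.V,
      ∃ (h₁ : G.1.delete {x} ∈ 𝓕) (h₂ : G.1.delete ({x} ∪ G.1.graph.neighborSet x) ∈ 𝓕),
        β ⟨_, h₂⟩ < β G ∧ β ⟨_, h₁⟩ ≤ β G)
    (G : 𝓕) :
    ∃ r : ℤ, HasRegularity (G.1.edgeIdeal K) r ∧ r ≤ (β G : ℤ) := by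
  have := G.1.finite
  have h := regLE_edgeVarIdeal K 𝓕 β hβ hvertex _ G rfl id Function.injective_id ∅ (fun _ h => h)
  rw [FinGraph.edgeIdeal_eq]
  -- It remains to see that elements of the ideal have no constant term: the monomial 1 is divisible
  -- by no edge.
  refine h.exists_hasRegularity (isHomogIdeal_edgeVarIdeal _ _ _) fun p hp => ?_
  rw [mem_edgeVarIdeal Function.injective_id] at hp
  rw [constantCoeff_eq, ← notMem_support_iff]
  intro h0
  obtain ⟨a, b, -, ha, -⟩ | ⟨z, hz, -⟩ := hp 0 h0
  · exact ha rfl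
  · exact hz
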